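/- Fix a complex number $q\neq 0,\pm1$ and a value of $\log q$, and set $q^\alpha=\exp(\alpha\log q)$ for $\alpha\in\mathbb C$. Let $N\ge 2$, let $\boldsymbol l=(l_1,\dots,l_{N-1})$ be nonnegative integers with the convention $l_0=l_N=0$, let $\boldsymbol T=(T_1,\dots,T_{N-1})$ be monic polynomials in $\mathbb C[x]$, put $T_N=1$, and let $\boldsymbol\lambda=(\lambda_1,\dots,\lambda_N)\in\mathbb C^N$. *Bethe ansatz equations.* For $\boldsymbol t=(t^{(i)}_j)_{1\le i\le N-1,\;1\le j\le l_i}$ with complex coordinates, these are the equations $$T_i(t^{(i)}_jq^2)\prod_{r=1}^{l_{i-1}}(t^{(i)}_jq-t^{(i-1)}_rq^{-1})\prod_{s=1}^{l_{i+1}}(t^{(i)}_j-t^{(i+1)}_s)\prod_{k\ne j}(t^{(i)}_jq^{-1}-t^{(i)}_kq)$$ $$=q^{2(\lambda_{i+1}-\lambda_i+l_i)-l_{i-1}-l_{i+1}}\,T_i(t^{(i)}_j)\prod_{r=1}^{l_{i-1}}(t^{(i)}_j-t^{(i-1)}_r)\prod_{s=1}^{l_{i+1}}(t^{(i)}_jq^{-1}-t^{(i+1)}_sq)\prod_{k\ne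 j}(t^{(i)}_jq-t^{(i)}_kq^{-1})$$ for $i=1,\dots,N-1$, $j=1,\dots,l_i$. The point $\boldsymbol t$ is *admissible* if $t^{(i)}_j\ne t^{(i)}_kq^2$ for all $i$ and all $j,k$ (including $j=k$). Put $p_i(x)=\prod_{j=1}^{l_i}(x-t^{(i)}_j)$, $p_0=p_N=1$, and $$P_i(x)=q^{2\lambda_{i+1}}p_i(xq^2)p_{i-1}(x)p_{i+1}(xq^{-2})T_i(x)+q^{2\lambda_i}p_i(xq^{-2})p_{i-1}(xq^2)p_{i+1}(x)T_i(xq^2).$$ A solution $\boldsymbol t$ is *regular* if for every $i=1,\dots,N-1$ and every $I\subset\{1,\dots,l_i\}$ such that all $t^{(i)}_j$, $j\in I$, equal a common value $c$, one has $P_i^{(k)}(c)=0$ for $k=0,\dots,|I|-1$. (This is automatic for a solution if, for each $i$, the numbers $t^{(i)}_1,\dots,t^{(i)}_{l_i}$ are distinct and nonzero.) *Quasi-polynomials and difference operators.* A quasi-polynomial of type $\alpha\in\mathbb C$ is a function $f(x)=x^\alpha p(x,\log x)$ with $p$ a polynomial in two variables; it is regarded as a holomorphic function of $\log x\in\mathbb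 C$, and $f(xq^\beta)$ is obtained by replacing $\log x$ with $\log x+\beta\log q$. Let $(\tau f)(x)=f(xq^{-2})$. The discrete Wronskian is $W_k[g_1,\dots,g_k](x)=\det\bigl(g_i(xq^{-2(j-1)})\bigr)_{i,j=1}^k$. A collection of quasi-polynomials of type $\boldsymbol\lambda$ is a sequence $\mathcal U=(u_1,\dots,u_N)$, where $u_i$ is a quasi-polynomial of type $\lambda_i$ and $W_N[u_1,\dots,u_N]\neq0$. Its fundamental difference operator $D_{\mathcal U}$ is the unique monic difference operator $\tau^N+a_{N-1}\tau^{N-1}+\dots+a_0$, whose coefficients $a_j$ are meromorphic functions of $\log x\in\mathbb C$, such that $D_{\mathcal U}u_i=0$ for all $i$. The fundamental difference operator of a point $\boldsymbol t$ is $$D^{\boldsymbol t}=\Bigl(\tau-q^{-2\lambda_1}\frac{R_1(xq^{-2})}{R_1(x)}\Bigr)\cdots\Bigl(\tau-q^{-2\lambda_N}\frac{R_N(xq^{-2})}{R_N(x)}\Bigr),\qquad R_i(x)=\frac{p_{i-1}(x)}{p_i(x)}\prod_{j=i}^{N-1}T_j(xq^{2(i-j)}).$$ **Statement.** Let $\boldsymbol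 t$ be an admissible regular solution of the Bethe ansatz equations associated with $\boldsymbol l,\boldsymbol T,\boldsymbol\lambda$. Then there exists a collection $\mathcal U=(u_1,\dots,u_N)$ of quasi-polynomials of type $\boldsymbol\lambda$ such that $D^{\boldsymbol t}=D_{\mathcal U}$ and $$W_N[u_1,\dots,u_N](x)=x^{\lambda_1+\dots+\lambda_N}\prod_{i=1}^N\prod_{j=0}^{N-i}T_{N-i+1}(xq^{-2j}).$$ -/

import Mathlib

open Polynomial

noncomputable section

namespace XXZ

/-! ### Functions on the universal cover of the punctured complex plane

A multivalued function `f(x)` such as `x ^ α` or `log x` is a function of the coordinate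
`s = log x ∈ ℂ` on the universal cover of `ℂ \ {0}`, where `x = exp s`.  The substitution
`x ↦ x q ^ β`, `log x ↦ log x + β log q` is the translation `s ↦ s + β log q`. -/

/-- The algebra of holomorphic functions of `s = log x ∈ ℂ`. -/
def holoSubalgebra : Subalgebra ℂ (ℂ → ℂ) where
  carrier := {f | Differentiable ℂ f}
  mul_mem' hf hg := Differentiable.mul hf hg
  add_mem' hf hg := Differentiable.add hf hg
  algebraMap_mem' c := differentiable_const c

/-- Holomorphic functions on the universal cover of `ℂ \ {0}`. -/
abbrev Holo : Type := holoSubalgebra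

instance instIsDomainHolo : IsDomain Holo := by
  have h : NoZeroDivisors Holo := by
    refine ⟨fun {f g} hfg => ?_⟩
    have hf : AnalyticOnNhd ℂ (f : ℂ → ℂ) Set.univ :=
      (Differentiable.differentiableOn f.2).analyticOnNhd isOpen_univ
    have hg : AnalyticOnNhd ℂ (g : ℂ → ℂ) Set.univ :=
      (Differentiable.differentiableOn g.2).analyticOnNhd isOpen_univ
    have hz : ∀ z ∈ (Set.univ : Set ℂ), (f : ℂ → ℂ) z * (g : ℂ → ℂ) z = 0 :=
      fun z _ => congrFun (congrArg Subtype.val hfg) z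
    rcases AnalyticOnNhd.eq_zero_or_eq_zero_of_mul_eq_zero hf hg hz
      isPreconnected_univ with h | h
    · exact Or.inl (Subtype.ext (funext fun z => h z (Set.mem_univ z)))
    · exact Or.inr (Subtype.ext (funext fun z => h z (Set.mem_univ z)))
  exact NoZeroDivisors.to_isDomain Holo

/-- The field of meromorphic functions on the universal cover of `ℂ \ {0}`, realized as the
field of quotients of holomorphic functions. -/
abbrev Mero : Type := FractionRing Holo

/-- A holomorphic function of `s`, as an element of `Holo`. -/
def toHolo (f : ℂ → ℂ) (hf : Differentiable ℂ f) : Holo := ⟨f, hf⟩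

/-- The translation `f(s) ↦ f(s + c)` on holomorphic functions. -/
def holoShift (c : ℂ) : Holo ≃ₐ[ℂ] Holo where
  toFun f := toHolo (fun s => (f : ℂ → ℂ) (s + c))
    (Differentiable.comp f.2 (differentiable_id.add_const c))
  invFun f := toHolo (fun s => (f : ℂ → ℂ) (s - c))
    (Differentiable.comp f.2 (differentiable_id.sub_const c))
  left_inv f := by ext s; simp [toHolo]
  right_inv f := by ext s; simp [toHolo]
  map_mul' _ _ := rfl
  map_add' _ _ := rfl
  commutes' _ := rfl

/-- `q ^ α = exp (α log q)`, for the fixed value `logq` of `log q`. -/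
def qpow (logq α : ℂ) : ℂ := Complex.exp (α * logq)

/-- The operator `(τ f)(x) = f(x q⁻²)` on meromorphic functions, that is, the unique extension
to quotients of the translation `s ↦ s - 2 log q`. -/
def tau (logq : ℂ) : Module.End ℂ Mero :=
  (IsFractionRing.algEquivOfAlgEquiv (R := ℂ) (K := Mero) (L := Mero)
    (holoShift (-2 * logq))).toLinearMap

/-- The function `x`. -/
def xFun : Mero :=
  algebraMap Holo Mero (toHolo Complex.exp Complex.differentiable_exp)

/-- The function `log x`. -/
def logFun : Mero :=
  algebraMap Holo Mero (toHolo (fun s => s) differentiable_id)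

/-- The function `x ^ α`. -/
def xPow (α : ℂ) : Mero :=
  algebraMap Holo Mero (toHolo (fun s => Complex.exp (α * s))
    (Complex.differentiable_exp.comp (differentiable_id.const_mul α)))

/-- A polynomial in `x`, as a function. -/
def polyFun (p : ℂ[X]) : Mero := aeval xFun p

/-- The polynomial `p(c x)`. -/
def scale (c : ℂ) (p : ℂ[X]) : ℂ[X] := p.comp (C c * X)

/-! ### Quasi-polynomials, discrete Wronskians, difference operators -/

/-- `f(x) = x ^ α p(x, log x)` for some polynomial `p(x, s)`.  In `p : ℂ[X][X]` the inner
variable is evaluated at `x` and the outer one at `log x`. -/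
def IsQuasiPolynomial (α : ℂ) (f : Mero) : Prop :=
  ∃ p : ℂ[X][X], f = xPow α * aevalAeval xFun logFun p

/-- The matrix with entries `(τ ^ (j-1) g_i)(x) = g_i(x q ^ (-2 (j-1)))`, `i, j = 1, …, k`. -/
def wronskianMatrix (logq : ℂ) {k : ℕ} (g : Fin k → Mero) : Matrix (Fin k) (Fin k) Mero :=
  Matrix.of fun i j => (tau logq ^ (j : ℕ)) (g i)

/-- The discrete Wronskian `W_k[g_1, …, g_k]`. -/
def wronskian (logq : ℂ) {k : ℕ} (g : Fin k → Mero) : Mero := (wronskianMatrix logq g).det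

/-- The operator of multiplication by `a`. -/
def mulOp (a : Mero) : Module.End ℂ Mero := LinearMap.mulLeft ℂ a

/-- `D = a_0 + a_1 τ + … + a_{N-1} τ ^ (N-1) + τ ^ N`, for some functions `a_0, …, a_{N-1}`. -/
def IsMonicDifferenceOperator (logq : ℂ) (N : ℕ) (D : Module.End ℂ Mero) : Prop :=
  ∃ a : Fin N → Mero, D = ∑ j : Fin N, mulOp (a j) * tau logq ^ (j : ℕ) + tau logq ^ N

/-- A collection of quasi-polynomials `(u_1, …, u_N)` of type `(λ_1, …, λ_N)`.  The function
`u i`, `i : Fin N`, is `u_{i+1}`; the sequence `lam` is indexed by `1, …, N`. -/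
structure Collection (logq : ℂ) (N : ℕ) (lam : ℕ → ℂ) where
  u : Fin N → Mero
  isQuasiPolynomial : ∀ i : Fin N, IsQuasiPolynomial (lam ((i : ℕ) + 1)) (u i)
  wronskian_ne_zero : wronskian logq u ≠ 0

theorem existsUnique_fundamentalOperator (logq : ℂ) {N : ℕ} (u : Fin N → Mero)
    (hu : wronskian logq u ≠ 0) :
    ∃! D : Module.End ℂ Mero, IsMonicDifferenceOperator logq N D ∧ ∀ i, D (u i) = 0 := by
  have key : ∀ (a : Fin N → Mero) (i : Fin N),
      (∑ j : Fin N, mulOp (a j) * tau logq ^ (j : ℕ) + tau logq ^ N) (u i) =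
        ((wronskianMatrix logq u).mulVec a) i + (tau logq ^ N) (u i) := by
    intro a i
    simp [mulOp, Matrix.mulVec, dotProduct, wronskianMatrix, LinearMap.sum_apply, mul_comm]
  have hM : IsUnit (wronskianMatrix logq u).det := isUnit_iff_ne_zero.mpr hu
  refine ⟨∑ j : Fin N, mulOp (((wronskianMatrix logq u)⁻¹.mulVec
      fun i => -(tau logq ^ N) (u i)) j) * tau logq ^ (j : ℕ) + tau logq ^ N,
    ⟨⟨_, rfl⟩, fun i => ?_⟩, ?_⟩
  · rw [key _ i, Matrix.mulVec_mulVec, Matrix.mul_nonsing_inv _ hM, Matrix.one_mulVec]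
    simp
  · rintro D ⟨⟨a, rfl⟩, hD⟩
    have ha : a = (wronskianMatrix logq u)⁻¹.mulVec fun i => -(tau logq ^ N) (u i) := by
      have h1 : (wronskianMatrix logq u).mulVec a = fun i => -(tau logq ^ N) (u i) := by
        funext i
        exact eq_neg_of_add_eq_zero_left ((key a i).symm.trans (hD i))
      rw [← h1, Matrix.mulVec_mulVec, Matrix.nonsing_inv_mul _ hM, Matrix.one_mulVec]
    rw [ha]

/-- The fundamental difference operator `D_U`: the unique monic difference operator of order `N`
such that `D_U u_i = 0` for all `i = 1, …, N`. -/
def Collection.fundamentalOperator {logq : ℂ} {N : ℕ} {lam : ℕ → ℂ}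
    (U : Collection logq N lam) : Module.End ℂ Mero :=
  (existsUnique_fundamentalOperator logq U.u U.wronskian_ne_zero).choose

/-! ### Bethe ansatz equations

All sequences are indexed from `1` as usual: `l i`, `T i`, `t i` for `i = 1, …, N-1` and `lam i`
for `i = 1, …, N`, with the convention `l 0 = l N = 0`.  The numbers `t_1^{(i)}, …, t_{l_i}^{(i)}`
are the values of `t i : Fin (l i) → ℂ`. -/

/-- The Bethe ansatz equations associated with the data `l`, `T`, `lam`. -/
def IsBetheSolution (logq : ℂ) (N : ℕ) (l : ℕ → ℕ) (T : ℕ → ℂ[X]) (lam : ℕ → ℂ)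
    (t : (i : ℕ) → Fin (l i) → ℂ) : Prop :=
  ∀ i ∈ Finset.Icc 1 (N - 1), ∀ j : Fin (l i),
    (T i).eval (t i j * qpow logq 2)
      * (∏ r, (t i j * qpow logq 1 - t (i - 1) r * qpow logq (-1)))
      * (∏ s, (t i j - t (i + 1) s))
      * (∏ k ∈ Finset.univ.erase j, (t i j * qpow logq (-1) - t i k * qpow logq 1))
    = qpow logq (2 * (lam (i + 1) - lam i + (l i : ℂ)) - (l (i - 1) : ℂ) - (l (i + 1) : ℂ))
      * (T i).eval (t i j)
      * (∏ r, (t i j - t (i - 1) r))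
      * (∏ s, (t i j * qpow logq (-1) - t (i + 1) s * qpow logq 1))
      * (∏ k ∈ Finset.univ.erase j, (t i j * qpow logq 1 - t i k * qpow logq (-1)))

/-- `t_j^{(i)} ≠ t_k^{(i)} q²` for all `i`, `j`, `k` (including `j = k`). -/
def IsAdmissible (logq : ℂ) (N : ℕ) (l : ℕ → ℕ) (t : (i : ℕ) → Fin (l i) → ℂ) : Prop :=
  ∀ i ∈ Finset.Icc 1 (N - 1), ∀ j k : Fin (l i), t i j ≠ t i k * qpow logq 2

/-- `p_i(x) = ∏_j (x - t_j^{(i)})`; the product is empty for `i = 0` and `i = N`. -/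
def pPoly {l : ℕ → ℕ} (t : (i : ℕ) → Fin (l i) → ℂ) (i : ℕ) : ℂ[X] :=
  ∏ j : Fin (l i), (X - C (t i j))

/-- The polynomial
`P_i(x) = q^{2 λ_{i+1}} p_i(x q²) p_{i-1}(x) p_{i+1}(x q⁻²) T_i(x)
  + q^{2 λ_i} p_i(x q⁻²) p_{i-1}(x q²) p_{i+1}(x) T_i(x q²)`. -/
def PPoly (logq : ℂ) {l : ℕ → ℕ} (T : ℕ → ℂ[X]) (lam : ℕ → ℂ)
    (t : (i : ℕ) → Fin (l i) → ℂ) (i : ℕ) : ℂ[X] :=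
  C (qpow logq (2 * lam (i + 1))) * scale (qpow logq 2) (pPoly t i) * pPoly t (i - 1)
      * scale (qpow logq (-2)) (pPoly t (i + 1)) * T i
    + C (qpow logq (2 * lam i)) * scale (qpow logq (-2)) (pPoly t i)
      * scale (qpow logq 2) (pPoly t (i - 1)) * pPoly t (i + 1) * scale (qpow logq 2) (T i)

/-- Regularity: whenever the coordinates `t_j^{(i)}`, `j ∈ I`, have a common value `c`, the
derivatives of `P_i` of orders `0, …, |I| - 1` vanish at `c`. -/
def IsRegular (logq : ℂ) (N : ℕ) (l : ℕ → ℕ) (T : ℕ → ℂ[X]) (lam : ℕ → ℂ)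
    (t : (i : ℕ) → Fin (l i) → ℂ) : Prop :=
  ∀ i ∈ Finset.Icc 1 (N - 1), ∀ (I : Finset (Fin (l i))) (c : ℂ), (∀ j ∈ I, t i j = c) →
    ∀ k < I.card, (derivative^[k] (PPoly logq T lam t i)).eval c = 0

/-- `R_i(x) = (p_{i-1}(x) / p_i(x)) ∏_{j=i}^{N-1} T_j(x q^{2(i-j)})`. -/
def RFun (logq : ℂ) (N : ℕ) {l : ℕ → ℕ} (T : ℕ → ℂ[X])
    (t : (i : ℕ) → Fin (l i) → ℂ) (i : ℕ) : Mero :=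
  polyFun (pPoly t (i - 1)) / polyFun (pPoly t i)
    * ∏ j ∈ Finset.Icc i (N - 1), polyFun (scale (qpow logq (2 * ((i : ℂ) - (j : ℂ)))) (T j))

/-- The fundamental difference operator of the point `t`: the composition, in this order, of
the operators `τ - q^{-2 λ_i} R_i(x q⁻²) / R_i(x)`, `i = 1, …, N`. -/
def pointOperator (logq : ℂ) (N : ℕ) {l : ℕ → ℕ} (T : ℕ → ℂ[X]) (lam : ℕ → ℂ)
    (t : (i : ℕ) → Fin (l i) → ℂ) : Module.End ℂ Mero :=
  ((List.range N).map fun m =>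
    tau logq - mulOp (qpow logq (-2 * lam (m + 1)) •
      (tau logq (RFun logq N T t (m + 1)) / RFun logq N T t (m + 1)))).prod

end XXZ

end

noncomputable section

namespace XXZ

/-! ### Difference equations in polynomials in `x` and `log x` -/

/-! The operator `D^t` is a product of factors τ - b_i, and the i-th one kills x^{λ_i} R_i. For each
k, u_{k+1} is obtained by lifting x^{λ_{k+1}} R_{k+1} through the factors to its right: v_k =
x^{λ_{k+1}} R_{k+1} and (τ - b_{i+2}) v_{i+1} = -v_i. The ansatz v_i = x^{λ_{k+1}} f_i S_{i+1} /
p_{i+1}, with S_i = ∏_{j≥i} T_j(x q^{2(i-j)}), turns each lift into a discrete Wronskian equation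
for f_{i+1} in ℂ[x, log x]. At the last step p_N = S_N = 1, so v_{N-1} is a quasi-polynomial.

Three facts make these equations solvable (`exists_wronskian_eq`). Admissibility makes p_i and its
shift coprime. Regularity means p_i ∣ P_i, and this divisibility passes from p_i to f_i along the
chain (`bethe_dvd_of_wronskian_eq`). Finally, f ↦ a f - b τf is onto ℂ[x, log x] when a ≠ 0 and log
q ≠ 0 (`biv_sub_shift_surjective`); logarithms enter exactly at resonances.

For the Wronskian, monic tails of `D^t` replace the powers of τ (`wronskian_eq_det_opProd`). The
matrix becomes antitriangular with antidiagonal ±x^{λ_i} R_i, and the p_i telescope in ∏ R_i. Since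
the Wronskian is nonzero, uniqueness identifies `D^t` with the fundamental operator. -/

/-- The first order difference operator `g(s) ↦ a g(s) - b g(s - h)` with constant coefficients. -/
def constDiff (a b h : ℂ) : ℂ[X] →ₗ[ℂ] ℂ[X] :=
  a • LinearMap.id - b • taylor (-h)

theorem constDiff_X_pow_coeff (a b h : ℂ) (n k : ℕ) :
    (constDiff a b h (X ^ n)).coeff k =
      a * (if k = n then 1 else 0) - b * ((-h) ^ (n - k) * (n.choose k : ℂ)) := by
  simp only [constDiff, LinearMap.sub_apply, LinearMap.smul_apply, LinearMap.id_apply,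
    taylor_X_pow, coeff_sub, coeff_smul, coeff_X_pow, coeff_X_add_C_pow, smul_eq_mul]

theorem constDiff_X_pow_degree {a b h : ℂ} (hab : a ≠ b) (n : ℕ) :
    (constDiff a b h (X ^ n)).degree = n := by
  refine le_antisymm ?_ ?_
  · rw [degree_le_iff_coeff_zero]
    intro k hk
    have hk : n < k := by exact_mod_cast hk
    rw [constDiff_X_pow_coeff, if_neg hk.ne', Nat.choose_eq_zero_of_lt hk]
    simp
  · refine le_degree_of_ne_zero ?_
    rw [constDiff_X_pow_coeff]
    simpa [sub_eq_zero] using hab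

/-- Resonant case: the leading terms cancel, and the next coefficient is a h (n+1), so the degree
drops by exactly one. -/
theorem constDiff_X_pow_succ_degree {a h : ℂ} (ha : a ≠ 0) (hh : h ≠ 0) (n : ℕ) :
    (constDiff a a h (X ^ (n + 1))).degree = n := by
  refine le_antisymm ?_ ?_
  · rw [degree_le_iff_coeff_zero]
    intro k hk
    have hk : n < k := by exact_mod_cast hk
    rw [constDiff_X_pow_coeff]
    rcases (Nat.succ_le_of_lt hk).eq_or_lt with h | h
    · subst h; simp
    · rw [if_neg h.ne', Nat.choose_eq_zero_of_lt h]
      simp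
  · refine le_degree_of_ne_zero ?_
    rw [constDiff_X_pow_coeff]
    have h2 : (n : ℂ) + 1 ≠ 0 := by exact_mod_cast Nat.succ_ne_zero n
    simp [ha, hh, h2]

theorem constDiff_surjective {a h : ℂ} (b : ℂ) (ha : a ≠ 0) (hh : h ≠ 0) :
    Function.Surjective (constDiff a b h) := by
  rw [← LinearMap.range_eq_top]
  -- Over a field, one polynomial of each degree spans, so it suffices to find such a sequence in
  -- the range.
  have key : ∀ S : Polynomial.Sequence ℂ, (∀ n, S n ∈ LinearMap.range (constDiff a b h)) →
      LinearMap.range (constDiff a b h) = ⊤ := by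
    intro S hS
    rw [eq_top_iff, ← S.span fun i => isUnit_iff_ne_zero.mpr
      (leadingCoeff_ne_zero.mpr (S.ne_zero i)), Submodule.span_le]
    rintro _ ⟨n, rfl⟩
    exact hS n
  by_cases hab : a = b
  · subst hab
    exact key ⟨fun n => constDiff a a h (X ^ (n + 1)), constDiff_X_pow_succ_degree ha hh⟩
      fun n => ⟨_, rfl⟩
  · exact key ⟨fun n => constDiff a b h (X ^ n), constDiff_X_pow_degree hab⟩ fun n => ⟨_, rfl⟩

/-- The substitution `x ↦ x q⁻²`, `log x ↦ log x - 2 log q` in polynomials in `x` (the inner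
variable) and `log x` (the outer variable). -/
def bivShift (logq : ℂ) : ℂ[X][X] →ₐ[ℂ] ℂ[X][X] :=
  aevalAeval (C (C (qpow logq (-2)) * X)) (X - C (C (2 * logq)))

theorem bivShift_C (logq : ℂ) (p : ℂ[X]) :
    bivShift logq (C p) = C (scale (qpow logq (-2)) p) := by
  rw [bivShift, aevalAeval_C, scale, comp]
  exact (aeval_algHom_apply (CAlgHom (R := ℂ) (A := ℂ[X])) _ p)

theorem bivShift_X (logq : ℂ) : bivShift logq X = X - C (C (2 * logq)) := by
  simp [bivShift]

theorem bivShift_map (logq : ℂ) (g : ℂ[X]) :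
    bivShift logq (g.map C) = (taylor (-(2 * logq)) g).map C := by
  induction g using Polynomial.induction_on' with
  | add p r hp hr => simp [hp, hr]
  | monomial n c =>
    rw [← C_mul_X_pow_eq_monomial]
    simp only [Polynomial.map_mul, map_C, Polynomial.map_pow, map_X, map_mul, map_pow, bivShift_X,
      bivShift_C, taylor_mul, taylor_C, taylor_X_pow, Polynomial.map_add, scale, C_comp]
    rw [sub_eq_add_neg, map_neg, map_neg, map_mul, map_mul]

/-- The operator preserves each x^m ℂ[log x] and acts there as `constDiff` with b replaced by b
q^{-2m}. -/
theorem biv_sub_shift_surjective {logq : ℂ} (hq : logq ≠ 0) {a : ℂ} (b : ℂ) (ha : a ≠ 0)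
    (g : ℂ[X][X]) : ∃ f : ℂ[X][X], C (C a) * f - C (C b) * bivShift logq f = g := by
  have base : ∀ (m : ℕ) (g : ℂ[X]), ∃ f : ℂ[X][X],
      C (C a) * f - C (C b) * bivShift logq f = C (X ^ m) * g.map C := by
    intro m g
    obtain ⟨f, hf⟩ := constDiff_surjective (h := 2 * logq) (b * qpow logq (-2) ^ m) ha
      (mul_ne_zero two_ne_zero hq) g
    refine ⟨C (X ^ m) * f.map C, ?_⟩
    rw [map_mul, bivShift_C, bivShift_map, ← hf, scale]
    simp only [constDiff, LinearMap.sub_apply, LinearMap.smul_apply, LinearMap.id_apply,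
      Polynomial.map_sub, smul_eq_C_mul, Polynomial.map_mul, map_C, X_pow_comp, mul_pow, map_mul,
      map_pow, Polynomial.map_pow]
    ring
  have add : ∀ g₁ g₂ : ℂ[X][X],
      (∃ f, C (C a) * f - C (C b) * bivShift logq f = g₁) →
      (∃ f, C (C a) * f - C (C b) * bivShift logq f = g₂) →
      ∃ f, C (C a) * f - C (C b) * bivShift logq f = g₁ + g₂ := by
    rintro _ _ ⟨f₁, rfl⟩ ⟨f₂, rfl⟩
    exact ⟨f₁ + f₂, by rw [map_add]; ring⟩
  induction g using Polynomial.induction_on' with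
  | add p r hp hr => exact add p r hp hr
  | monomial n c =>
    induction c using Polynomial.induction_on' with
    | add p r hp hr => rw [map_add]; exact add _ _ hp hr
    | monomial m c =>
      obtain ⟨f, hf⟩ := base m (C c * X ^ n)
      refine ⟨f, hf.trans ?_⟩
      rw [← C_mul_X_pow_eq_monomial, ← C_mul_X_pow_eq_monomial]
      simp only [Polynomial.map_mul, map_C, Polynomial.map_pow, map_X, map_mul]
      ring

/-! ### Discrete Wronskian equations -/

section Abstract

variable {B : Type*} [CommRing B] (σ : B →+* B)

/-- Solvability of the discrete Wronskian equation `a f σ(p) - b p σ(f) = A`. -/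
theorem exists_wronskian_eq {p A a b a' b' : B} (hp : IsCoprime p (σ p))
    (ha : a * a' = 1) (hb : b * b' = 1) (hσa : σ a' = a')
    (hsurj : ∀ g, ∃ f, a * f - b * σ f = g)
    (hdvd : σ p ∣ a' * p * σ A + b' * σ (σ p) * A) :
    ∃ f, a * f * σ p - b * p * σ f = A := by
  obtain ⟨u, v, huv⟩ := hp
  have huv' : σ u * σ p + σ v * σ (σ p) = 1 := by
    rw [← map_mul, ← map_mul, ← map_add, huv, map_one]
  -- Modulo σp both u p and σ(v) σ(σp) equal 1, so the right side is b times the expression in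
  -- `hdvd`. The factor p σ(σp) is a unit modulo σp and can then be cancelled.
  have h1 : σ p ∣ (p * σ (σ p)) * (A * u + b * a' * σ (A * v)) := by
    obtain ⟨w, hw⟩ := hdvd
    refine ⟨b * w - b * a' * p * σ A * σ u - σ (σ p) * A * v, ?_⟩
    rw [map_mul]
    linear_combination b * hw + σ (σ p) * A * huv + b * a' * p * σ A * huv'
      - σ (σ p) * A * hb
  have hc : IsCoprime (σ p) (p * σ (σ p)) :=
    IsCoprime.mul_right ⟨v, u, by rw [add_comm]; exact huv⟩ ⟨σ u, σ v, huv'⟩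
  obtain ⟨g, hg⟩ := hc.dvd_of_dvd_mul_left h1
  obtain ⟨e, he⟩ := hsurj g
  -- The Bezout term solves the equation up to a multiple of p σ(p); the correction p e changes the
  -- left side by p σ(p) (a e - b σe), which removes that error.
  refine ⟨a' * (A * v) + p * e, ?_⟩
  rw [map_add, map_mul, map_mul, hσa, map_mul] at *
  linear_combination A * huv + (A * v * σ p) * ha - p * hg + p * σ p * he

/-- The Bethe divisibility condition is inherited by a solution of the previous discrete
Wronskian equation. -/
theorem bethe_dvd_of_wronskian_eq {p₀ p p₂ T T₀ f f₀ a₀ a₀' a' b b' : B}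
    (hp : IsCoprime p₀ (σ p₀)) (ha₀ : a₀ * a₀' = 1) (hb : b * b' = 1)
    (hf : a₀ * f * σ p₀ - b * p₀ * σ f = f₀ * T₀ * σ p)
    (hdvd : σ p ∣ a' * p * σ (p₀ * T * σ p₂) + a₀' * σ (σ p) * (p₀ * T * σ p₂)) :
    σ p ∣ a' * p * σ (f * T * σ p₂) + b' * σ (σ p) * (f * T * σ p₂) := by
  obtain ⟨w, hw⟩ := hdvd
  simp only [map_mul] at hw ⊢
  obtain ⟨u, v, huv⟩ := hp
  set Y := a' * p * (σ f * σ T * σ (σ p₂)) + b' * σ (σ p) * (f * T * σ p₂) with hY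
  -- Modulo σp, `hf` reads a₀ f σ(p₀) ≡ b p₀ σ(f). Hence p₀ Y and σ(p₀) Y are multiples of the
  -- expression in `hdvd`, by f and by σ(f) up to constants; coprimality of p₀ and σ(p₀) then
  -- recovers Y.
  have h1 : σ p ∣ p₀ * Y := by
    refine ⟨a₀ * b' * f * w - b' * a' * p * σ T * σ (σ p₂) * (f₀ * T₀), ?_⟩
    rw [hY]
    linear_combination a₀ * b' * f * hw - b' * a' * p * σ T * σ (σ p₂) * hf
      - a' * p * σ T * σ (σ p₂) * p₀ * σ f * hb
      - b' * f * σ (σ p) * p₀ * T * σ p₂ * ha₀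
  have h2 : σ p ∣ σ p₀ * Y := by
    refine ⟨σ f * w + b' * a₀' * σ (σ p) * T * σ p₂ * (f₀ * T₀), ?_⟩
    rw [hY]
    linear_combination σ f * hw + b' * a₀' * σ (σ p) * T * σ p₂ * hf
      + a₀' * σ (σ p) * p₀ * σ f * T * σ p₂ * hb
      - b' * σ (σ p) * T * σ p₂ * f * σ p₀ * ha₀
  have h3 : Y = u * (p₀ * Y) + v * (σ p₀ * Y) := by linear_combination (-Y) * huv
  rw [h3]
  exact dvd_add (h1.mul_left u) (h2.mul_left v)

/-- Successive solution of the discrete Wronskian equations, starting from `f k = p k`. -/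
theorem exists_wronskian_chain {p T a a' : ℕ → B} {M k : ℕ}
    (hp : ∀ i, 1 ≤ i → i ≤ M → IsCoprime (p i) (σ (p i)))
    (ha : ∀ i, a i * a' i = 1) (hσa : ∀ i, σ (a' i) = a' i)
    (hsurj : ∀ i g, ∃ f, a i * f - a (k + 1) * σ f = g)
    (hdvd : ∀ i < M, σ (p (i + 1)) ∣
      a' (i + 2) * p (i + 1) * σ (p i * T (i + 1) * σ (p (i + 2)))
        + a' (i + 1) * σ (σ (p (i + 1))) * (p i * T (i + 1) * σ (p (i + 2)))) :
    ∃ f : ℕ → B, f k = p k ∧ ∀ i, k ≤ i → i < M →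
      a (i + 2) * f (i + 1) * σ (p (i + 1)) - a (k + 1) * p (i + 1) * σ (f (i + 1))
        = f i * T (i + 1) * σ (p (i + 2)) := by
  suffices h : ∀ n ≤ M, k ≤ n → ∃ f : ℕ → B, f k = p k ∧ ∀ i, k ≤ i → i < n →
      a (i + 2) * f (i + 1) * σ (p (i + 1)) - a (k + 1) * p (i + 1) * σ (f (i + 1))
        = f i * T (i + 1) * σ (p (i + 2)) by
    rcases le_total k M with hkM | hkM
    · exact h M le_rfl hkM
    · exact ⟨p, rfl, fun i h1 h2 => absurd h2 (by omega)⟩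
  intro n hnM hkn
  induction n, hkn using Nat.le_induction with
  | base => exact ⟨p, rfl, fun i h1 h2 => absurd h2 (by omega)⟩
  | succ n hkn ih =>
    obtain ⟨f, hfk, hf⟩ := ih (by omega)
    have hd : σ (p (n + 1)) ∣
        a' (n + 2) * p (n + 1) * σ (f n * T (n + 1) * σ (p (n + 2)))
          + a' (k + 1) * σ (σ (p (n + 1))) * (f n * T (n + 1) * σ (p (n + 2))) := by
      -- At n = k the Bethe condition applies directly, since f k = p k. Later the preceding
      -- Wronskian equation transfers it from p n to f n, replacing a'(n+1) by a'(k+1).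
      rcases hkn.eq_or_lt with h | h
      · subst h
        rw [hfk]
        exact hdvd k (by omega)
      · obtain ⟨m, rfl⟩ : ∃ m, n = m + 1 := ⟨n - 1, by omega⟩
        exact bethe_dvd_of_wronskian_eq σ (hp (m + 1) (by omega) (by omega)) (ha _) (ha _)
          (hf m (by omega) (by omega)) (hdvd (m + 1) (by omega))
    obtain ⟨g, hg⟩ := exists_wronskian_eq σ (hp (n + 1) (by omega) hnM) (ha (n + 2)) (ha (k + 1))
      (hσa _) (hsurj (n + 2)) hd
    refine ⟨Function.update f (n + 1) g, ?_, fun i h1 h2 => ?_⟩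
    · rw [Function.update_of_ne (by omega), hfk]
    · rcases (Nat.lt_succ_iff.mp h2).eq_or_lt with h | h
      · subst h
        rw [Function.update_self, Function.update_of_ne (by omega)]
        exact hg
      · rw [Function.update_of_ne (by omega), Function.update_of_ne (by omega)]
        exact hf i h1 h

end Abstract

/-! ### The Bethe divisibility conditions -/

theorem qpow_add (logq a b : ℂ) : qpow logq (a + b) = qpow logq a * qpow logq b := by
  rw [qpow, qpow, qpow, add_mul, Complex.exp_add]

theorem qpow_zero (logq : ℂ) : qpow logq 0 = 1 := by simp [qpow]

theorem qpow_ne_zero (logq a : ℂ) : qpow logq a ≠ 0 := Complex.exp_ne_zero _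

theorem qpow_mul_neg (logq a : ℂ) : qpow logq a * qpow logq (-a) = 1 := by
  rw [← qpow_add, add_neg_cancel, qpow_zero]

theorem scale_scale (c d : ℂ) (p : ℂ[X]) : scale c (scale d p) = scale (d * c) p := by
  simp only [scale, comp_assoc, mul_comp, C_comp, X_comp, map_mul, mul_assoc]

theorem scale_one (p : ℂ[X]) : scale 1 p = p := by simp [scale]

theorem scale_mul (c : ℂ) (p r : ℂ[X]) : scale c (p * r) = scale c p * scale c r := mul_comp ..

theorem scale_prod {ι : Type*} (c : ℂ) (s : Finset ι) (p : ι → ℂ[X]) :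
    scale c (∏ i ∈ s, p i) = ∏ i ∈ s, scale c (p i) := by
  simp only [scale, prod_comp]

theorem scale_ne_zero {c : ℂ} (hc : c ≠ 0) {p : ℂ[X]} (hp : p ≠ 0) : scale c p ≠ 0 := by
  intro h
  have h1 : scale c⁻¹ (scale c p) = p := by
    rw [scale_scale, mul_inv_cancel₀ hc, scale_one]
  rw [h] at h1
  exact hp (by rw [← h1, scale, zero_comp])

theorem monic_pPoly {l : ℕ → ℕ} (t : (i : ℕ) → Fin (l i) → ℂ) (i : ℕ) : (pPoly t i).Monic :=
  monic_prod_of_monic _ _ fun j _ => monic_X_sub_C (t i j)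

theorem pPoly_eq_one {l : ℕ → ℕ} (t : (i : ℕ) → Fin (l i) → ℂ) {i : ℕ} (h : l i = 0) :
    pPoly t i = 1 := by
  have : IsEmpty (Fin (l i)) := by rw [h]; infer_instance
  exact Fintype.prod_empty _

theorem isCoprime_pPoly_scale {logq : ℂ} {N : ℕ} {l : ℕ → ℕ} {t : (i : ℕ) → Fin (l i) → ℂ}
    (hadm : IsAdmissible logq N l t) {i : ℕ} (hi : i ∈ Finset.Icc 1 (N - 1)) :
    IsCoprime (pPoly t i) (scale (qpow logq (-2)) (pPoly t i)) := by
  rw [pPoly, scale_prod]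
  refine IsCoprime.prod_left fun j _ => IsCoprime.prod_right fun k _ => ?_
  have h2 : t i j * qpow logq (-2) - t i k ≠ 0 := by
    intro h
    apply hadm i hi j k
    rw [sub_eq_zero] at h
    rw [← h, mul_assoc, mul_comm (qpow logq (-2)), qpow_mul_neg, mul_one]
  -- Eliminating x between the two linear factors leaves t_j q^{-2} - t_k, which is a unit by
  -- admissibility.
  refine ⟨C (-(qpow logq (-2)) / (t i j * qpow logq (-2) - t i k)),
    C (1 / (t i j * qpow logq (-2) - t i k)), ?_⟩
  rw [scale, sub_comp, X_comp, C_comp]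
  have h3 : C (-(qpow logq (-2)) / (t i j * qpow logq (-2) - t i k)) * (X - C (t i j))
      + C (1 / (t i j * qpow logq (-2) - t i k)) * (C (qpow logq (-2)) * X - C (t i k))
      = C ((1 / (t i j * qpow logq (-2) - t i k)) * (t i j * qpow logq (-2) - t i k)) := by
    simp only [div_eq_mul_inv, map_mul, map_sub, map_neg, one_mul]
    ring
  rw [h3, one_div_mul_cancel h2, C_1]

/-- Regularity, applied to the full fibre of `t i` over c, bounds the multiplicity of c as a root of
P_i below by its multiplicity in p_i. -/
theorem pPoly_dvd_PPoly {logq : ℂ} {N : ℕ} {l : ℕ → ℕ} {T : ℕ → ℂ[X]} {lam : ℕ → ℂ}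
    {t : (i : ℕ) → Fin (l i) → ℂ} (hreg : IsRegular logq N l T lam t) {i : ℕ}
    (hi : i ∈ Finset.Icc 1 (N - 1)) : pPoly t i ∣ PPoly logq T lam t i := by
  classical
  by_cases h0 : PPoly logq T lam t i = 0
  · rw [h0]; exact dvd_zero _
  have h1 : pPoly t i = ((Finset.univ.val.map (t i)).map fun a => X - C a).prod := by
    rw [pPoly, Multiset.map_map]; rfl
  rw [h1, Multiset.prod_X_sub_C_dvd_iff_le_roots h0, Multiset.le_iff_count]
  intro c
  rw [count_roots, Multiset.count_map]
  set I : Finset (Fin (l i)) := Finset.univ.filter fun j => c = t i j with hI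
  change I.card ≤ _
  rcases Nat.eq_zero_or_pos I.card with h | h
  · omega
  · have := (lt_rootMultiplicity_iff_isRoot_iterate_derivative (n := I.card - 1) (t := c) h0).mpr
      fun k hk => hreg i hi I c (fun j hj => (Finset.mem_filter.mp hj).2.symm) k (by omega)
    omega

/-- This is p_{i+1} ∣ P_{i+1} after x ↦ x q^{-2}, which leaves only nonnegative powers of the shift,
as the abstract lemmas require. -/
theorem bethe_dvd {logq : ℂ} {N : ℕ} {l : ℕ → ℕ} {T : ℕ → ℂ[X]} {lam : ℕ → ℂ}
    {t : (i : ℕ) → Fin (l i) → ℂ} (hreg : IsRegular logq N l T lam t) {i : ℕ}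
    (hi : i < N - 1) :
    let σ := scale (qpow logq (-2))
    let p := pPoly t
    σ (p (i + 1)) ∣
      C (qpow logq (2 * lam (i + 2))) * p (i + 1) * σ (p i * T (i + 1) * σ (p (i + 2)))
        + C (qpow logq (2 * lam (i + 1))) * σ (σ (p (i + 1))) *
          (p i * T (i + 1) * σ (p (i + 2))) := by
  intro σ p
  have hσ : ∀ r, σ (scale (qpow logq 2) r) = r := fun r => by
    simp only [σ]
    rw [scale_scale, qpow_mul_neg, scale_one]
  obtain ⟨w, hw⟩ := pPoly_dvd_PPoly hreg (Finset.mem_Icc.mpr ⟨Nat.succ_pos i, hi⟩)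
  refine ⟨σ w, ?_⟩
  have h2 : σ (PPoly logq T lam t (i + 1)) = σ (pPoly t (i + 1)) * σ w := by
    rw [hw]; exact scale_mul _ _ _
  rw [← h2]
  have hadd : ∀ f g, σ (f + g) = σ f + σ g := fun f g => add_comp ..
  have hmul : ∀ f g, σ (f * g) = σ f * σ g := fun f g => mul_comp ..
  have hC : ∀ c, σ (C c) = C c := fun c => C_comp ..
  rw [PPoly, hadd]
  simp only [hmul, hC, hσ, Nat.add_sub_cancel]
  simp only [σ, p]
  ring

/-! ### The shift of meromorphic functions -/

theorem tau_algebraMap (logq : ℂ) (f : Holo) :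
    tau logq (algebraMap Holo Mero f) = algebraMap Holo Mero (holoShift (-2 * logq) f) :=
  IsFractionRing.algEquivOfAlgEquiv_algebraMap _ f

/-- The shift `τ` as an automorphism of the field of meromorphic functions. -/
def tauEquiv (logq : ℂ) : Mero ≃ₐ[ℂ] Mero :=
  IsFractionRing.algEquivOfAlgEquiv (R := ℂ) (K := Mero) (L := Mero) (holoShift (-2 * logq))

theorem tau_apply (logq : ℂ) (f : Mero) : tau logq f = tauEquiv logq f := rfl

theorem tau_xFun (logq : ℂ) : tau logq xFun = qpow logq (-2) • xFun := by
  rw [xFun, tau_algebraMap, Algebra.smul_def, IsScalarTower.algebraMap_apply ℂ Holo Mero,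
    ← map_mul]
  congr 1
  ext s
  change Complex.exp (s + -2 * logq) = Complex.exp (-2 * logq) * Complex.exp s
  rw [Complex.exp_add, mul_comm]

theorem tau_logFun (logq : ℂ) : tau logq logFun = logFun - algebraMap ℂ Mero (2 * logq) := by
  rw [logFun, tau_algebraMap, IsScalarTower.algebraMap_apply ℂ Holo Mero, ← map_sub]
  congr 1
  ext s
  change s + -2 * logq = s - 2 * logq
  ring

theorem tau_xPow (logq α : ℂ) : tau logq (xPow α) = qpow logq (-2 * α) • xPow α := by
  rw [xPow, tau_algebraMap, Algebra.smul_def, IsScalarTower.algebraMap_apply ℂ Holo Mero,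
    ← map_mul]
  congr 1
  ext s
  change Complex.exp (α * (s + -2 * logq)) = Complex.exp (-2 * α * logq) * Complex.exp (α * s)
  rw [← Complex.exp_add]
  congr 1
  ring

theorem xPow_ne_zero (α : ℂ) : xPow α ≠ 0 := by
  intro h
  have h := (FaithfulSMul.algebraMap_eq_zero_iff Holo Mero).mp h
  exact Complex.exp_ne_zero (α * 0) (congrFun (congrArg Subtype.val h) 0)

theorem xPow_zero : xPow 0 = 1 := by
  rw [xPow, ← map_one (algebraMap Holo Mero)]
  congr 1
  ext s
  change Complex.exp (0 * s) = 1
  simp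

theorem xPow_add (α β : ℂ) : xPow (α + β) = xPow α * xPow β := by
  rw [xPow, xPow, xPow, ← map_mul]
  congr 1
  ext s
  change Complex.exp ((α + β) * s) = Complex.exp (α * s) * Complex.exp (β * s)
  rw [← Complex.exp_add, add_mul]

theorem xPow_sum {ι : Type*} (s : Finset ι) (α : ι → ℂ) :
    xPow (∑ i ∈ s, α i) = ∏ i ∈ s, xPow (α i) := by
  classical
  induction s using Finset.induction_on with
  | empty => simp [xPow_zero]
  | insert a s ha ih => rw [Finset.sum_insert ha, Finset.prod_insert ha, xPow_add, ih]

/-- Since exp maps onto ℂ \ {0}, a polynomial vanishing as a function of s has infinitely many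
roots. -/
theorem polyFun_ne_zero {p : ℂ[X]} (hp : p ≠ 0) : polyFun p ≠ 0 := by
  intro h
  apply hp
  rw [polyFun, xFun, aeval_algebraMap_apply] at h
  have h := (FaithfulSMul.algebraMap_eq_zero_iff Holo Mero).mp h
  refine eq_zero_of_infinite_isRoot p (Set.Infinite.mono (s := {0}ᶜ) ?_ ?_)
  · intro z hz
    obtain ⟨s, rfl⟩ : ∃ s, Complex.exp s = z := ⟨Complex.log z, Complex.exp_log hz⟩
    have h1 := congrFun (congrArg holoSubalgebra.val h) s
    rw [← aeval_algHom_apply] at h1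
    have h2 := aeval_algHom_apply (Pi.evalAlgHom ℂ (fun _ : ℂ => ℂ) s)
      (holoSubalgebra.val (toHolo Complex.exp Complex.differentiable_exp)) p
    rw [Set.mem_ofPred_eq, IsRoot, ← coe_aeval_eq_eval]
    exact h2.trans h1
  · exact (Set.finite_singleton (0 : ℂ)).infinite_compl

/-- Evaluation of polynomials in `x` and `log x`. -/
def bivFun : ℂ[X][X] →ₐ[ℂ] Mero := aevalAeval xFun logFun

theorem bivFun_C (p : ℂ[X]) : bivFun (C p) = polyFun p := aevalAeval_C ..

theorem tau_bivFun (logq : ℂ) (f : ℂ[X][X]) :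
    tau logq (bivFun f) = bivFun (bivShift logq f) := by
  suffices h : (tauEquiv logq).toAlgHom.comp bivFun = bivFun.comp (bivShift logq) from
    DFunLike.congr_fun h f
  have hx : bivFun (C X) = xFun := aevalAeval_X ..
  have hy : bivFun X = logFun := aevalAeval_Y ..
  apply (aevalAevalEquiv ℂ Mero).symm.injective
  refine Prod.ext ?_ ?_
  · change tau logq (bivFun (C X)) = bivFun (bivShift logq (C X))
    rw [bivShift_C, scale, X_comp, hx, tau_xFun, map_mul, map_mul, hx, Algebra.smul_def]
    congr 1
    exact (bivFun.commutes _).symm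
  · change tau logq (bivFun X) = bivFun (bivShift logq X)
    rw [bivShift_X, hy, tau_logFun, map_sub, hy]
    congr 1
    exact (bivFun.commutes _).symm

theorem tau_polyFun (logq : ℂ) (p : ℂ[X]) :
    tau logq (polyFun p) = polyFun (scale (qpow logq (-2)) p) := by
  rw [← bivFun_C, tau_bivFun, bivShift_C, bivFun_C]

/-! ### Products of first order difference operators -/

theorem mulOp_apply (a f : Mero) : mulOp a f = a * f := rfl

/-- The product `(τ - c 0) ⋯ (τ - c (n - 1))`. -/
def opProd (logq : ℂ) (c : ℕ → Mero) (n : ℕ) : Module.End ℂ Mero :=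
  ((List.range n).map fun m => tau logq - mulOp (c m)).prod

theorem opProd_succ (logq : ℂ) (c : ℕ → Mero) (n : ℕ) :
    opProd logq c (n + 1) = (tau logq - mulOp (c 0)) * opProd logq (fun m => c (m + 1)) n := by
  rw [opProd, List.range_succ_eq_map, List.map_cons, List.prod_cons, List.map_map]
  rfl

theorem exists_opProd_apply_eq (logq : ℂ) (c : ℕ → Mero) (n : ℕ) :
    ∃ a : ℕ → Mero, a n = 1 ∧ (∀ j, n < j → a j = 0) ∧
      ∀ f, opProd logq c n f = ∑ j ∈ Finset.range (n + 1), a j * (tau logq ^ j) f := by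
  induction n generalizing c with
  | zero =>
    refine ⟨fun j => if j = 0 then 1 else 0, if_pos rfl, fun j hj => if_neg hj.ne', fun f => ?_⟩
    simp [opProd]
  | succ n ih =>
    obtain ⟨a, han, ha, hf⟩ := ih fun m => c (m + 1)
    -- Multiplying by τ on the left shifts the coefficients by one place and applies τ to them; the
    -- new constant coefficient is 0.
    let s : ℕ → Mero := fun j => Nat.casesOn j 0 fun j => tau logq (a j)
    refine ⟨fun j => s j - c 0 * a j, ?_, fun j hj => ?_, fun f => ?_⟩
    · change tau logq (a n) - c 0 * a (n + 1) = 1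
      rw [han, ha (n + 1) (Nat.lt_succ_self n), tau_apply, map_one, mul_zero, sub_zero]
    · obtain ⟨m, rfl⟩ : ∃ m, j = m + 1 := ⟨j - 1, by omega⟩
      change tau logq (a m) - c 0 * a (m + 1) = 0
      rw [ha m (by omega), ha (m + 1) (by omega), tau_apply, map_zero, mul_zero, sub_zero]
    · rw [opProd_succ]
      change tau logq (opProd logq _ n f) - c 0 * opProd logq _ n f = _
      simp only [sub_mul, Finset.sum_sub_distrib]
      rw [Finset.sum_range_succ' (fun j => s j * (tau logq ^ j) f),
        Finset.sum_range_succ (fun j => c 0 * a j * (tau logq ^ j) f) (n + 1),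
        ha (n + 1) (Nat.lt_succ_self n), hf, map_sum, Finset.mul_sum]
      change _ = ∑ j ∈ Finset.range (n + 1), tau logq (a j) * (tau logq ^ (j + 1)) f
        + 0 * _ - _
      rw [zero_mul, mul_zero, zero_mul, add_zero, add_zero]
      refine congrArg₂ _ (Finset.sum_congr rfl fun j _ => ?_)
        (Finset.sum_congr rfl fun j _ => (mul_assoc _ _ _).symm)
      rw [pow_succ', tau_apply, map_mul]
      rfl

theorem isMonicDifferenceOperator_opProd (logq : ℂ) (c : ℕ → Mero) (n : ℕ) :
    IsMonicDifferenceOperator logq n (opProd logq c n) := by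
  obtain ⟨a, han, -, hf⟩ := exists_opProd_apply_eq logq c n
  refine ⟨fun j => a j, LinearMap.ext fun f => ?_⟩
  rw [hf, Finset.sum_range_succ, han, one_mul, LinearMap.add_apply, LinearMap.sum_apply,
    Finset.sum_range]
  rfl

/-! ### Column reduction of the Wronskian -/

/-- The change of columns is unitriangular because the j-th operator is monic of order j. The family
`c` varies with j because tails of a product grow on the left, so their first coefficient changes
with the length. -/
theorem wronskian_eq_det_opProd (logq : ℂ) {N : ℕ} (u : Fin N → Mero) (c : ℕ → ℕ → Mero) :
    wronskian logq u = (Matrix.of fun i j : Fin N => opProd logq (c j) j (u i)).det := by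
  choose a ha1 ha0 hf using fun n => exists_opProd_apply_eq logq (c n) n
  have h1 : (Matrix.of fun i j : Fin N => opProd logq (c j) j (u i)) =
      wronskianMatrix logq u * Matrix.of fun m j : Fin N => a j m := by
    ext i j
    rw [Matrix.mul_apply, Matrix.of_apply, hf]
    simp only [wronskianMatrix, Matrix.of_apply]
    rw [Fin.sum_univ_eq_sum_range (fun m => (tau logq ^ m) (u i) * a j m) N]
    refine (Finset.sum_subset (Finset.range_subset_range.mpr j.2) fun m _ hm => ?_).trans
      (Finset.sum_congr rfl fun m _ => mul_comm _ _)
    rw [Finset.mem_range, not_lt] at hm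
    rw [ha0 _ _ hm, zero_mul]
  have h2 : (Matrix.of fun m j : Fin N => a j m).det = 1 := by
    rw [Matrix.det_of_isUpperTriangular]
    · exact Finset.prod_eq_one fun i _ => ha1 i
    · intro i j hij
      exact ha0 _ _ hij
  rw [h1, Matrix.det_mul, h2, mul_one]
  rfl

/-- In the last row only the entry in column 0 can survive, so expansion along that row gives an
induction with sign (-1)^n. -/
theorem det_of_antitriangular {R : Type*} [CommRing R] {n : ℕ} (M : Matrix (Fin n) (Fin n) R)
    (hM : ∀ i j : Fin n, n ≤ (i : ℕ) + j → M i j = 0) :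
    M.det = ∏ i : Fin n, (-1) ^ (i : ℕ) * M i i.rev := by
  induction n with
  | zero => simp
  | succ n ih =>
    rw [Matrix.det_succ_row M (Fin.last n), Finset.sum_eq_single 0, Fin.prod_univ_castSucc,
      mul_comm (Finset.prod _ _)]
    · have h1 : M.submatrix (Fin.last n).succAbove (Fin.succAbove 0)
          = M.submatrix Fin.castSucc Fin.succ := by
        rw [Fin.succAbove_last]; rfl
      rw [h1, ih]
      · simp [Fin.rev_castSucc]
      · intro i j hij
        refine hM _ _ ?_
        simp only [Fin.val_castSucc, Fin.val_succ]
        omega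
    · intro j _ hj
      have h0 : (j : ℕ) ≠ 0 := fun h => hj (Fin.ext h)
      rw [hM _ _ (by rw [Fin.val_last]; omega)]
      simp
    · simp

/-! ### The functions in the kernel of the fundamental difference operator of a point -/

/-- `S_i(x) = ∏_{j=i}^{N-1} T_j(x q^{2(i-j)})`. -/
def SPoly (logq : ℂ) (N : ℕ) (T : ℕ → ℂ[X]) (i : ℕ) : ℂ[X] :=
  ∏ j ∈ Finset.Icc i (N - 1), scale (qpow logq (2 * ((i : ℂ) - (j : ℂ)))) (T j)

theorem SPoly_eq_mul (logq : ℂ) {N : ℕ} (T : ℕ → ℂ[X]) {i : ℕ} (hi : i ≤ N - 1) :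
    SPoly logq N T i = T i * scale (qpow logq (-2)) (SPoly logq N T (i + 1)) := by
  rw [SPoly, ← Finset.mul_prod_Ioc_eq_prod_Icc hi, sub_self, mul_zero, qpow_zero, scale_one,
    SPoly, scale_prod, ← Finset.Icc_add_one_left_eq_Ioc]
  congr 1
  refine Finset.prod_congr rfl fun j _ => ?_
  rw [scale_scale, ← qpow_add]
  congr 2
  push_cast
  ring

theorem SPoly_self (logq : ℂ) {N : ℕ} (hN : N ≠ 0) (T : ℕ → ℂ[X]) : SPoly logq N T N = 1 := by
  rw [SPoly, Finset.Icc_eq_empty (by omega), Finset.prod_empty]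

theorem SPoly_ne_zero (logq : ℂ) {N : ℕ} {T : ℕ → ℂ[X]}
    (hT : ∀ i ∈ Finset.Icc 1 (N - 1), (T i).Monic) {i : ℕ} (hi : 1 ≤ i) :
    SPoly logq N T i ≠ 0 := by
  refine Finset.prod_ne_zero_iff.mpr fun j hj => scale_ne_zero (qpow_ne_zero _ _) (hT j ?_).ne_zero
  rw [Finset.mem_Icc] at hj ⊢
  omega

theorem RFun_eq (logq : ℂ) (N : ℕ) {l : ℕ → ℕ} (T : ℕ → ℂ[X]) (t : (i : ℕ) → Fin (l i) → ℂ)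
    (i : ℕ) : RFun logq N T t i =
      polyFun (pPoly t (i - 1)) / polyFun (pPoly t i) * polyFun (SPoly logq N T i) := by
  rw [RFun, SPoly]
  congr 1
  exact (map_prod (aeval (R := ℂ) xFun) _ _).symm

/-- The coefficient `q^{-2 λ_i} R_i(x q⁻²) / R_i(x)`. -/
def bCoeff (logq : ℂ) (N : ℕ) {l : ℕ → ℕ} (T : ℕ → ℂ[X]) (lam : ℕ → ℂ)
    (t : (i : ℕ) → Fin (l i) → ℂ) (i : ℕ) : Mero :=
  qpow logq (-2 * lam i) • (tau logq (RFun logq N T t i) / RFun logq N T t i)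

theorem tau_sub_bCoeff_apply_self (logq : ℂ) {N : ℕ} {l : ℕ → ℕ} {T : ℕ → ℂ[X]} (lam : ℕ → ℂ)
    (t : (i : ℕ) → Fin (l i) → ℂ) {i : ℕ} (h : RFun logq N T t i ≠ 0) :
    (tau logq - mulOp (bCoeff logq N T lam t i)) (xPow (lam i) * RFun logq N T t i) = 0 := by
  rw [LinearMap.sub_apply, mulOp_apply, bCoeff, tau_apply, map_mul, ← tau_apply, ← tau_apply,
    tau_xPow, Algebra.smul_def, Algebra.smul_def]
  field_simp
  ring

/-- The lifting equation with denominators cleared: primes denote τ, p and p₂ are p_{i+1} and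
p_{i+2}, s is S_{i+2}, r is T_{i+1}, and x stands for x^{λ_{k+1}}. -/
theorem field_wronskian_step {K : Type*} [Field K] {a b x f f' f₀ r p p' p₂ p₂' s s' : K}
    (hp : p ≠ 0) (hp₂ : p₂ ≠ 0) (hp₂' : p₂' ≠ 0) (hs : s ≠ 0)
    (h : a * f * p' - b * p * f' = f₀ * r * p₂') :
    b * x * f' * (s' / p₂') - a * ((p' / p₂' * s') / (p / p₂ * s)) * (x * f * (s / p₂)) =
      -(x * f₀ * (r * s' / p)) := by
  field_simp
  linear_combination (-(x * s')) * h

theorem exists_polynomial_chain {logq : ℂ} (hq : logq ≠ 0) {N : ℕ} {l : ℕ → ℕ}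
    {T : ℕ → ℂ[X]} {lam : ℕ → ℂ} {t : (i : ℕ) → Fin (l i) → ℂ}
    (hreg : IsRegular logq N l T lam t) (hadm : IsAdmissible logq N l t) (k : ℕ) :
    ∃ f : ℕ → ℂ[X][X], f k = C (pPoly t k) ∧ ∀ i, k ≤ i → i < N - 1 →
      C (C (qpow logq (-2 * lam (i + 2)))) * f (i + 1) * bivShift logq (C (pPoly t (i + 1)))
        - C (C (qpow logq (-2 * lam (k + 1)))) * C (pPoly t (i + 1)) * bivShift logq (f (i + 1))
      = f i * C (T (i + 1)) * bivShift logq (C (pPoly t (i + 2))) := by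
  refine exists_wronskian_chain (bivShift logq).toRingHom (p := fun i => C (pPoly t i))
    (T := fun i => C (T i)) (a := fun i => C (C (qpow logq (-2 * lam i))))
    (a' := fun i => C (C (qpow logq (2 * lam i)))) (M := N - 1) ?_ ?_ ?_ ?_ ?_
  · intro i h1 h2
    have h := (isCoprime_pPoly_scale hadm (Finset.mem_Icc.mpr ⟨h1, h2⟩)).map (C : ℂ[X] →+* _)
    rw [← bivShift_C] at h
    exact h
  · intro i
    rw [← map_mul, ← map_mul, mul_comm, neg_mul, qpow_mul_neg, C_1, C_1]
  · intro i
    change bivShift logq (C (C _)) = _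
    rw [bivShift_C, scale, C_comp]
  · intro i g
    exact biv_sub_shift_surjective hq _ (qpow_ne_zero _ _) g
  · intro i hi
    have h := map_dvd (C : ℂ[X] →+* ℂ[X][X]) (bethe_dvd hreg hi)
    simp only [map_add, map_mul, ← bivShift_C] at h
    simp only [AlgHom.toRingHom_eq_coe, RingHom.coe_coe, map_mul]
    exact h

theorem exists_kernel_chain {logq : ℂ} (hq : logq ≠ 0) {N : ℕ} {l : ℕ → ℕ}
    {T : ℕ → ℂ[X]} (hT : ∀ i ∈ Finset.Icc 1 (N - 1), (T i).Monic) (hlN : l N = 0)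
    {lam : ℕ → ℂ} {t : (i : ℕ) → Fin (l i) → ℂ}
    (hreg : IsRegular logq N l T lam t) (hadm : IsAdmissible logq N l t) {k : ℕ} (hk : k < N) :
    ∃ v : ℕ → Mero, IsQuasiPolynomial (lam (k + 1)) (v (N - 1)) ∧
      v k = xPow (lam (k + 1)) * RFun logq N T t (k + 1) ∧
      ∀ i, k ≤ i → i < N - 1 →
        (tau logq - mulOp (bCoeff logq N T lam t (i + 2))) (v (i + 1)) = - v i := by
  obtain ⟨f, hfk, hf⟩ := exists_polynomial_chain hq hreg hadm k
  have hp : ∀ i, polyFun (pPoly t i) ≠ 0 := fun i => polyFun_ne_zero (monic_pPoly t i).ne_zero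
  refine ⟨fun i => xPow (lam (k + 1)) * bivFun (f i) *
    (polyFun (SPoly logq N T (i + 1)) / polyFun (pPoly t (i + 1))), ⟨f (N - 1), ?_⟩, ?_, ?_⟩
  · beta_reduce
    rw [show N - 1 + 1 = N by omega, SPoly_self logq (by omega), pPoly_eq_one t hlN, div_self,
      mul_one]
    · rfl
    · exact polyFun_ne_zero one_ne_zero
  · beta_reduce
    rw [hfk, bivFun_C, RFun_eq, Nat.add_sub_cancel]
    ring
  · intro i h1 h2
    have e := congrArg bivFun (hf i h1 h2)
    simp only [map_sub, map_mul, ← tau_bivFun, bivFun_C] at e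
    have hS := SPoly_eq_mul logq T (i := i + 1) h2
    have hS' : polyFun (SPoly logq N T (i + 1)) =
        polyFun (T (i + 1)) * tau logq (polyFun (SPoly logq N T (i + 1 + 1))) := by
      rw [hS, tau_polyFun]
      exact map_mul (aeval (R := ℂ) xFun) _ _
    have hτ : ∀ x, x ≠ 0 → tau logq x ≠ 0 := fun x hx => by
      rw [tau_apply]; exact (_root_.map_ne_zero _).mpr hx
    have key := field_wronskian_step (x := xPow (lam (k + 1)))
      (s' := tau logq (polyFun (SPoly logq N T (i + 1 + 1)))) (hp (i + 1)) (hp (i + 2))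
      (hτ _ (hp (i + 2))) (polyFun_ne_zero (SPoly_ne_zero logq hT (i := i + 1 + 1) (by omega))) e
    beta_reduce
    rw [hS', ← key, LinearMap.sub_apply, mulOp_apply, bCoeff, RFun_eq]
    have hc : ∀ c : ℂ, polyFun (C c) = algebraMap ℂ Mero c := fun c => aeval_C xFun c
    have hm : ∀ x y, tau logq (x * y) = tau logq x * tau logq y := fun x y =>
      map_mul (tauEquiv logq) x y
    have hd : ∀ x y, tau logq (x / y) = tau logq x / tau logq y := fun x y =>
      map_div₀ (tauEquiv logq) x y
    simp only [hm, hd, tau_xPow, Algebra.smul_def, hc]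
    rfl

theorem RFun_ne_zero (logq : ℂ) {N : ℕ} {l : ℕ → ℕ} {T : ℕ → ℂ[X]}
    (hT : ∀ i ∈ Finset.Icc 1 (N - 1), (T i).Monic) (t : (i : ℕ) → Fin (l i) → ℂ) {i : ℕ}
    (hi : 1 ≤ i) : RFun logq N T t i ≠ 0 := by
  have hp : ∀ i, polyFun (pPoly t i) ≠ 0 := fun i => polyFun_ne_zero (monic_pPoly t i).ne_zero
  rw [RFun_eq]
  exact mul_ne_zero (div_ne_zero (hp _) (hp _)) (polyFun_ne_zero (SPoly_ne_zero logq hT hi))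

/-- The product of the last `n` factors of the fundamental difference operator of a point. -/
def tailOperator (logq : ℂ) (N : ℕ) {l : ℕ → ℕ} (T : ℕ → ℂ[X]) (lam : ℕ → ℂ)
    (t : (i : ℕ) → Fin (l i) → ℂ) (n : ℕ) : Module.End ℂ Mero :=
  opProd logq (fun m => bCoeff logq N T lam t (m + 1 + (N - n))) n

theorem tailOperator_succ (logq : ℂ) {N : ℕ} {l : ℕ → ℕ} (T : ℕ → ℂ[X]) (lam : ℕ → ℂ)
    (t : (i : ℕ) → Fin (l i) → ℂ) {n : ℕ} (hn : n < N) :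
    tailOperator logq N T lam t (n + 1) =
      (tau logq - mulOp (bCoeff logq N T lam t (N - n))) * tailOperator logq N T lam t n := by
  rw [tailOperator, opProd_succ, tailOperator, show 0 + 1 + (N - (n + 1)) = N - n by omega]
  congr 3
  funext m
  congr 1
  omega

theorem tailOperator_self (logq : ℂ) (N : ℕ) {l : ℕ → ℕ} (T : ℕ → ℂ[X]) (lam : ℕ → ℂ)
    (t : (i : ℕ) → Fin (l i) → ℂ) :
    tailOperator logq N T lam t N = pointOperator logq N T lam t := by
  rw [tailOperator, Nat.sub_self]
  rfl

/-- A quasi-polynomial of type `λ_{k+1}` killed by the last `N - k` factors of the fundamental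
difference operator, and mapped to `x ^ λ_{k+1} R_{k+1}`, up to a sign, by the last `N - k - 1`. -/
theorem exists_kernel_element {logq : ℂ} (hq : logq ≠ 0) {N : ℕ} {l : ℕ → ℕ}
    {T : ℕ → ℂ[X]} (hT : ∀ i ∈ Finset.Icc 1 (N - 1), (T i).Monic) (hlN : l N = 0)
    {lam : ℕ → ℂ} {t : (i : ℕ) → Fin (l i) → ℂ}
    (hreg : IsRegular logq N l T lam t) (hadm : IsAdmissible logq N l t) {k : ℕ} (hk : k < N) :
    ∃ u : Mero, IsQuasiPolynomial (lam (k + 1)) u ∧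
      tailOperator logq N T lam t (N - 1 - k) u =
        (-1) ^ (N - 1 - k) * (xPow (lam (k + 1)) * RFun logq N T t (k + 1)) ∧
      ∀ n, N - k ≤ n → n ≤ N → tailOperator logq N T lam t n u = 0 := by
  obtain ⟨v, hqp, hvk, hv⟩ := exists_kernel_chain hq hT hlN hreg hadm hk
  -- Each factor descends the chain by one index at the cost of a sign.
  have h1 : ∀ n, n + k ≤ N - 1 →
      tailOperator logq N T lam t n (v (N - 1)) = (-1) ^ n * v (N - 1 - n) := by
    intro n
    induction n with
    | zero => intro _; simp [tailOperator, opProd]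
    | succ n ih =>
      intro hn
      have h := hv (N - 1 - (n + 1)) (by omega) (by omega)
      rw [show N - 1 - (n + 1) + 2 = N - n by omega,
        show N - 1 - (n + 1) + 1 = N - 1 - n by omega] at h
      have hs : ((-1 : Mero) ^ n) * v (N - 1 - n) = (-1 : ℂ) ^ n • v (N - 1 - n) := by
        rw [Algebra.smul_def, map_pow, map_neg, map_one]
      rw [tailOperator_succ _ _ _ _ (by omega), Module.End.mul_apply, ih (by omega), hs, map_smul,
        h, Algebra.smul_def, map_pow, map_neg, map_one, pow_succ]
      ring
  have h2 : tailOperator logq N T lam t (N - 1 - k) (v (N - 1)) =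
      (-1) ^ (N - 1 - k) * (xPow (lam (k + 1)) * RFun logq N T t (k + 1)) := by
    rw [h1 _ (by omega), show N - 1 - (N - 1 - k) = k by omega, hvk]
  refine ⟨v (N - 1), hqp, h2, fun n h3 h4 => ?_⟩
  -- The tail of length N - k adds the factor that kills x^{λ_{k+1}} R_{k+1}; longer tails act on
  -- zero.
  induction n, h3 using Nat.le_induction with
  | base =>
    have hs : ∀ x : Mero, (-1 : Mero) ^ (N - 1 - k) * x = (-1 : ℂ) ^ (N - 1 - k) • x := fun x => by
      rw [Algebra.smul_def, map_pow, map_neg, map_one]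
    rw [show N - k = N - 1 - k + 1 by omega, tailOperator_succ _ _ _ _ (by omega),
      Module.End.mul_apply, h2, show N - (N - 1 - k) = k + 1 by omega, hs, map_smul,
      tau_sub_bCoeff_apply_self _ _ _ (RFun_ne_zero logq hT t (by omega)), smul_zero]
  | succ n h3 ih =>
    rw [tailOperator_succ _ _ _ _ (by omega), Module.End.mul_apply, ih (by omega), map_zero]

/-! ### Value of the Wronskian and conclusion -/

theorem prod_Icc_one_eq_prod_range {M : Type*} [CommMonoid M] (f : ℕ → M) (N : ℕ) :
    ∏ i ∈ Finset.Icc 1 N, f i = ∏ i ∈ Finset.range N, f (i + 1) := by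
  induction N with
  | zero => simp
  | succ N ih => rw [Finset.prod_Icc_succ_top (by omega), Finset.prod_range_succ, ih]

theorem prod_RFun (logq : ℂ) {N : ℕ} {l : ℕ → ℕ} (hl₀ : l 0 = 0) (hlN : l N = 0)
    {T : ℕ → ℂ[X]} (hTN : T N = 1) (t : (i : ℕ) → Fin (l i) → ℂ) :
    ∏ i ∈ Finset.Icc 1 N, RFun logq N T t i =
      ∏ i ∈ Finset.Icc 1 N, ∏ j ∈ Finset.range (N - i + 1),
        polyFun (scale (qpow logq (-2 * (j : ℂ))) (T (N - i + 1))) := by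
  have hp : ∀ i, polyFun (pPoly t i) ≠ 0 := fun i => polyFun_ne_zero (monic_pPoly t i).ne_zero
  have h1 : ∏ i ∈ Finset.Icc 1 N, polyFun (pPoly t (i - 1)) / polyFun (pPoly t i) = 1 := by
    rw [prod_Icc_one_eq_prod_range]
    have h : ∀ n, ∏ i ∈ Finset.range n, polyFun (pPoly t (i + 1 - 1)) / polyFun (pPoly t (i + 1))
        = polyFun (pPoly t 0) / polyFun (pPoly t n) := by
      intro n
      induction n with
      | zero => rw [Finset.prod_range_zero, div_self (hp 0)]
      | succ n ih => rw [Finset.prod_range_succ, ih, Nat.add_sub_cancel, div_mul_div_cancel₀ (hp n)]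
    rw [h, pPoly_eq_one t hl₀, pPoly_eq_one t hlN, div_self (polyFun_ne_zero one_ne_zero)]
  simp only [RFun]
  rw [Finset.prod_mul_distrib, h1, one_mul]
  -- Adding the trivial factor T_N = 1 gives both double products the same triangular index set.
  have h2 : ∀ i ∈ Finset.Icc 1 N,
      ∏ j ∈ Finset.Icc i (N - 1), polyFun (scale (qpow logq (2 * ((i : ℂ) - (j : ℂ)))) (T j)) =
        ∏ j ∈ Finset.Icc i N, polyFun (scale (qpow logq (2 * ((i : ℂ) - (j : ℂ)))) (T j)) := by
    intro i hi
    rw [Finset.mem_Icc] at hi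
    obtain ⟨M, rfl⟩ : ∃ M, N = M + 1 := ⟨N - 1, by omega⟩
    rw [Finset.prod_Icc_succ_top hi.2, hTN, Nat.add_sub_cancel, scale, one_comp, polyFun, map_one,
      mul_one]
  rw [Finset.prod_congr rfl h2, Finset.prod_sigma', Finset.prod_sigma']
  refine Finset.prod_bij' (fun a _ => ⟨N + 1 - a.2, a.2 - a.1⟩)
    (fun a _ => ⟨N + 1 - a.1 - a.2, N + 1 - a.1⟩) ?_ ?_ ?_ ?_ ?_
  · rintro ⟨i, m⟩ h
    simp only [Finset.mem_sigma, Finset.mem_Icc, Finset.mem_range] at h ⊢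
    omega
  · rintro ⟨i, m⟩ h
    simp only [Finset.mem_sigma, Finset.mem_Icc, Finset.mem_range] at h ⊢
    omega
  · rintro ⟨i, m⟩ h
    simp only [Finset.mem_sigma, Finset.mem_Icc] at h
    simp only [Sigma.mk.injEq, heq_eq_eq]
    omega
  · rintro ⟨i, m⟩ h
    simp only [Finset.mem_sigma, Finset.mem_Icc, Finset.mem_range] at h
    simp only [Sigma.mk.injEq, heq_eq_eq]
    omega
  · rintro ⟨i, m⟩ h
    simp only [Finset.mem_sigma, Finset.mem_Icc] at h
    simp only
    rw [show N - (N + 1 - m) + 1 = m by omega, Nat.cast_sub h.2.1]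
    congr 3
    ring

theorem exists_collection {logq : ℂ} (hq : logq ≠ 0) {N : ℕ} {l : ℕ → ℕ}
    (hl₀ : l 0 = 0) (hlN : l N = 0) {T : ℕ → ℂ[X]}
    (hT : ∀ i ∈ Finset.Icc 1 (N - 1), (T i).Monic) (hTN : T N = 1)
    {lam : ℕ → ℂ} {t : (i : ℕ) → Fin (l i) → ℂ}
    (hreg : IsRegular logq N l T lam t) (hadm : IsAdmissible logq N l t) :
    ∃ U : Collection logq N lam, pointOperator logq N T lam t = U.fundamentalOperator ∧
      wronskian logq U.u = xPow (∑ i ∈ Finset.Icc 1 N, lam i) *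
        ∏ i ∈ Finset.Icc 1 N, ∏ j ∈ Finset.range (N - i + 1),
          polyFun (scale (qpow logq (-2 * (j : ℂ))) (T (N - i + 1))) := by
  choose u hqp hu hu0 using fun k : Fin N => exists_kernel_element hq hT hlN hreg hadm k.2
  have hW : wronskian logq u =
      ∏ i ∈ Finset.Icc 1 N, xPow (lam i) * RFun logq N T t i := by
    rw [wronskian_eq_det_opProd logq u
      fun n => fun m => bCoeff logq N T lam t (m + 1 + (N - n))]
    rw [det_of_antitriangular]
    · rw [prod_Icc_one_eq_prod_range,
        ← Fin.prod_univ_eq_prod_range (fun i => xPow (lam (i + 1)) * RFun logq N T t (i + 1))]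
      -- The cofactor sign (-1)^i and the chain sign (-1)^{N-1-i} combine to (-1)^{N-1} in every
      -- row, and N such signs multiply to 1 because N(N-1) is even.
      have h : ∀ i : Fin N, (-1 : Mero) ^ (i : ℕ) *
          (Matrix.of fun i j : Fin N => opProd logq
            (fun m => bCoeff logq N T lam t (m + 1 + (N - j))) j (u i)) i i.rev =
          (-1) ^ (N - 1) * (xPow (lam (i + 1)) * RFun logq N T t (i + 1)) := by
        intro i
        have h3 := hu i
        rw [tailOperator] at h3
        rw [Matrix.of_apply, Fin.val_rev, show N - ((i : ℕ) + 1) = N - 1 - i by omega, h3,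
          ← mul_assoc, ← pow_add, show (i : ℕ) + (N - 1 - i) = N - 1 by omega]
      rw [Finset.prod_congr rfl fun i _ => h i, Finset.prod_mul_distrib, Finset.prod_const,
        Finset.card_univ, Fintype.card_fin, ← pow_mul, mul_comm (N - 1),
        (Nat.even_mul_pred_self N).neg_one_pow, one_mul]
    · intro i j hij
      exact hu0 i j (by omega) j.2.le
  have hW0 : wronskian logq u ≠ 0 := by
    rw [hW]
    refine Finset.prod_ne_zero_iff.mpr fun i hi => mul_ne_zero (xPow_ne_zero _)
      (RFun_ne_zero logq hT t (Finset.mem_Icc.mp hi).1)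
  refine ⟨⟨u, hqp, hW0⟩, ?_, ?_⟩
  · refine (existsUnique_fundamentalOperator logq u hW0).unique ⟨?_, fun i => ?_⟩
      (existsUnique_fundamentalOperator logq u hW0).choose_spec.1
    · rw [← tailOperator_self]
      exact isMonicDifferenceOperator_opProd _ _ _
    · rw [← tailOperator_self]
      exact hu0 i N (Nat.sub_le _ _) le_rfl
  · change wronskian logq u = _
    rw [hW, Finset.prod_mul_distrib, ← xPow_sum, prod_RFun logq hl₀ hlN hTN]

end XXZ

end

theorem corollary5p10 (q logq : ℂ) (hlogq : Complex.exp logq = q) (hq₁ : q ≠ 1) (hq₂ : q ≠ -1)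
    (N : ℕ) (hN : 2 ≤ N) (l : ℕ → ℕ) (hl₀ : l 0 = 0) (hlN : l N = 0)
    (T : ℕ → Polynomial ℂ) (hT : ∀ i ∈ Finset.Icc 1 (N - 1), (T i).Monic) (hTN : T N = 1)
    (lam : ℕ → ℂ) (t : (i : ℕ) → Fin (l i) → ℂ)
    (hsol : XXZ.IsBetheSolution logq N l T lam t)
    (hreg : XXZ.IsRegular logq N l T lam t)
    (hadm : XXZ.IsAdmissible logq N l t) :
    ∃ U : XXZ.Collection logq N lam,
      XXZ.pointOperator logq N T lam t = U.fundamentalOperator ∧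
      XXZ.wronskian logq U.u =
        XXZ.xPow (∑ i ∈ Finset.Icc 1 N, lam i) *
          ∏ i ∈ Finset.Icc 1 N, ∏ j ∈ Finset.range (N - i + 1),
            XXZ.polyFun (XXZ.scale (XXZ.qpow logq (-2 * (j : ℂ))) (T (N - i + 1))) := by
  -- A nonzero step in log x is what solves the resonant equations.
  have hq : logq ≠ 0 := by
    rintro rfl
    exact hq₁ (by rw [← hlogq, Complex.exp_zero])
  exact XXZ.exists_collection hq hl₀ hlN hT hTN hreg hadm
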